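/- Let $d\ge 2$ be an integer, let $s>d$ and $\beta\in(0,\infty)$, and let $R$ be a $[0,\infty)$-valued random variable with absolutely continuous distribution such that $\lim_{h\to\infty}h^{s}\,\mathbb{P}(R>h)=\beta$. For $n\ge 1$ let $\mathbb{T}_n$ be the torus obtained from the cube $[-n/2,n/2]^d$ by the standard identification of its boundaries, equipped with the toroidal (quotient Euclidean) distance $\mathrm{d}_{\mathbb{T}_n}$ and with Lebesgue measure. Let $X^{(n)}$ be an independently $[0,\infty)$-marked homogeneous Poisson point process on $\mathbb{T}_n$ of intensity $1$ whose marks are distributed as $R$, that is, a Poisson point process on $\mathbb{T}_n\times[0,\infty)$ whose intensity measure is the product of Lebesgue measure and the distribution of $R$. Let $R^*$ be a copy of $R$ that is independent of $X^{(n)}$, and let $o\in\mathbb{T}_n$ be the origin. For a set $S\subset\mathbb{T}_n\times[0,\infty)$ let $G(S)$ be the graph with vertex set $S$ in which there is a directed edge from $(\xi,r)$ to $(\eta,t)$ if $\mathrm{d}_{\mathbb{T}_n}(\xi,\eta)\le r$; a vertex is isolated if there is no edge, in either direction, between it and a different vertex. Then the limit $$\lim_{n\to\infty}\mathbb{P}\big((o,R^*)\text{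 is isolated in }G(X^{(n)}\cup\{(o,R^*)\})\big)$$ exists and is strictly positive. It depends only on $d$ and the distribution of $R$, and it is the same along every sequence of real side lengths $n\ge 1$ that tends to infinity. -/

import Mathlib

open MeasureTheory ProbabilityTheory Filter Topology
open scoped NNReal ENNReal

noncomputable section

/-- The `d`-dimensional torus of side length `n`, that is `(ℝ / nℤ)^d`. -/
abbrev Torus (d : ℕ) (n : ℝ) : Type := Fin d → AddCircle n

/-- The toroidal distance: the quotient of the Euclidean distance. On each coordinate, the norm of
`AddCircle n` is the distance to `0` modulo `n`. -/
def torusDist {d : ℕ} {n : ℝ} (x y : Torus d n) : ℝ :=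
  Real.sqrt (∑ i, ‖x i - y i‖ ^ 2)

/-- Lebesgue measure on the torus: the image of Lebesgue measure on the cube `[-n/2, n/2]^d` under
the identification of its boundaries (its total mass is `n ^ d`). -/
def torusVolume (d : ℕ) (n : ℝ) : Measure (Torus d n) :=
  ((volume : Measure (Fin d → ℝ)).restrict
      (Set.Icc (fun _ => -(n / 2)) (fun _ => n / 2))).map
    (fun x i => (x i : AddCircle n))

/-- The number of points of the random set `X` in `B`. -/
def pointCount {Ω E : Type*} (X : Ω → Set E) (B : Set E) (ω : Ω) : ℕ∞ :=
  (X ω ∩ B).encard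

/-- The random set of points `X` is a (simple) Poisson point process with intensity measure `μ`:
the numbers of points in measurable sets are random variables, those in sets of finite intensity
are Poisson distributed with mean the intensity of the set, and those in disjoint sets are
independent. -/
structure IsPoissonProcess {Ω E : Type*} [MeasurableSpace Ω] [MeasurableSpace E]
    (X : Ω → Set E) (μ : Measure E) (P : Measure Ω) : Prop where
  measurable_count : ∀ B : Set E, MeasurableSet B → Measurable (pointCount X B)
  law_count : ∀ B : Set E, MeasurableSet B → μ B ≠ ∞ →
    P.map (pointCount X B) = (poissonMeasure (μ B).toNNReal).map (Nat.cast : ℕ → ℕ∞)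
  indep_count : ∀ (m : ℕ) (B : Fin m → Set E), (∀ i, MeasurableSet (B i)) →
    Pairwise (Function.onFun Disjoint B) → iIndepFun (fun i => pointCount X (B i)) P

/-- The σ-algebra generated by the random set of points `X`. -/
abbrev pointSigma {Ω E : Type*} [MeasurableSpace E] (X : Ω → Set E) : MeasurableSpace Ω :=
  ⨆ B : {B : Set E // MeasurableSet B}, MeasurableSpace.comap (pointCount X B.1) inferInstance

/-- The independently `[0, ∞)`-marked homogeneous Poisson point process of intensity `1` on the
torus of side length `n`, with mark distribution `Q`: the Poisson point process on
torus × `[0, ∞)` whose intensity measure is the product of Lebesgue measure and `Q`. -/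
def IsMarkedPoisson {Ω : Type*} [MeasurableSpace Ω] {d : ℕ} {n : ℝ}
    (X : Ω → Set (Torus d n × ℝ≥0)) (Q : Measure ℝ≥0) (P : Measure Ω) : Prop :=
  IsPoissonProcess X ((torusVolume d n).prod Q) P

/-- The scale-free Gilbert graph on the set `S` of marked points: there is a directed edge from
`(ξ, r)` to `(η, t)` if `η` lies in the closed ball of radius `r` around `ξ`. -/
def gilbertGraph {d : ℕ} {n : ℝ} (S : Set (Torus d n × ℝ≥0)) : Digraph S where
  Adj x y := torusDist x.1.1 y.1.1 ≤ (x.1.2 : ℝ)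

/-- The marked point `v` is an isolated vertex of the Gilbert graph on `S ∪ {v}`: there is no edge
in either direction between `v` and another vertex. -/
def IsIsolatedIn {d : ℕ} {n : ℝ} (S : Set (Torus d n × ℝ≥0)) (v : Torus d n × ℝ≥0) : Prop :=
  (gilbertGraph (S ∪ {v})).toSimpleGraphInclusive.IsIsolated ⟨v, Or.inr rfl⟩

end

/-! Conditionally on `R* = ρ`, the origin is isolated iff the Poisson process misses the set of `(ξ,
r)` with `d(0, ξ) ≤ max ρ r`, since an edge in either direction is excluded. Averaging the void
probability over `ρ` gives `∫ exp (-μₙ(Bₙ ρ)) dQ` (`measure_isIsolatedIn`). Unfolding the torus onto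
its cube turns `μₙ(Bₙ ρ)` into the measure of the Euclidean set cut off at the cube, which tends to
the full measure. That is finite because `s > d` gives the mark a finite `d`-th moment
(`lintegral_pow_lt_top_of_tail`). Dominated convergence with bound `1` yields the limit, and it is
positive because its integrand is positive at every `ρ`. The delicate point is the conditioning:
independence is known only for counts in fixed sets, while the set `B R` is random. In
`IsPoissonProcess.measure_void_random`, `R` is rounded up to a grid, and the mesh then tends to
zero. -/

/-- The smallest multiple of `1 / (m + 1)` that is strictly larger than `ρ`. -/
noncomputable def upperGrid (m : ℕ) (ρ : ℝ≥0) : ℝ≥0 := (⌊(m + 1 : ℝ≥0) * ρ⌋₊ + 1 : ℝ≥0) / (m + 1)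

lemma lt_upperGrid (m : ℕ) (ρ : ℝ≥0) : ρ < upperGrid m ρ := by
  rw [upperGrid, lt_div_iff₀ (by positivity), mul_comm]
  exact Nat.lt_floor_add_one _

lemma upperGrid_le (m : ℕ) (ρ : ℝ≥0) : upperGrid m ρ ≤ ρ + 1 / (m + 1) := by
  rw [upperGrid, div_le_iff₀ (by positivity), add_mul ρ, div_mul_cancel₀ _ (by positivity),
    mul_comm ρ]
  gcongr
  exact Nat.floor_le zero_le

lemma tendsto_upperGrid (ρ : ℝ≥0) : Tendsto (fun m => upperGrid m ρ) atTop (𝓝 ρ) := by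
  have h : Tendsto (fun m : ℕ => ρ + 1 / ((m : ℝ≥0) + 1)) atTop (𝓝 (ρ + 0)) :=
    tendsto_const_nhds.add tendsto_one_div_add_atTop_nhds_zero_nat
  rw [add_zero] at h
  exact tendsto_of_tendsto_of_tendsto_of_le_of_le tendsto_const_nhds h
    (fun m => (lt_upperGrid m ρ).le) (fun m => upperGrid_le m ρ)

/-! ### Void probabilities of Poisson processes -/

/-- The probability that a Poisson process of intensity measure `μ` has no point in `B`. -/
noncomputable def voidProb {E : Type*} [MeasurableSpace E] (μ : Measure E) (B : Set E) : ℝ≥0∞ :=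
  ENNReal.ofReal (Real.exp (-(μ B).toReal))

lemma voidProb_le_one {E : Type*} [MeasurableSpace E] (μ : Measure E) (B : Set E) :
    voidProb μ B ≤ 1 := by
  simp [voidProb]

lemma voidProb_anti {E : Type*} [MeasurableSpace E] {μ : Measure E} {A B : Set E}
    (h : A ⊆ B) (hB : μ B ≠ ∞) : voidProb μ B ≤ voidProb μ A := by
  unfold voidProb
  gcongr

lemma tendsto_voidProb {ι F : Type*} {E : ι → Type*} [∀ i, MeasurableSpace (E i)]
    [MeasurableSpace F] {l : Filter ι} {μ : ∀ i, Measure (E i)} {B : ∀ i, Set (E i)}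
    {ν : Measure F} {A : Set F} (hA : ν A ≠ ∞)
    (h : Tendsto (fun i => μ i (B i)) l (𝓝 (ν A))) :
    Tendsto (fun i => voidProb (μ i) (B i)) l (𝓝 (voidProb ν A)) :=
  ENNReal.tendsto_ofReal ((Real.continuous_exp.tendsto _).comp
    (((ENNReal.tendsto_toReal hA).comp h).neg))

lemma pointCount_eq_zero {Ω E : Type*} {X : Ω → Set E} {B : Set E} {ω : Ω} :
    pointCount X B ω = 0 ↔ ∀ p ∈ X ω, p ∉ B := by
  rw [pointCount, Set.encard_eq_zero, Set.eq_empty_iff_forall_notMem]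
  simp

section Poisson

variable {Ω E : Type*} [MeasurableSpace Ω] [MeasurableSpace E]
  {X : Ω → Set E} {μ : Measure E} {P : Measure Ω}

lemma IsPoissonProcess.measure_pointCount_eq_zero (hX : IsPoissonProcess X μ P) {B : Set E}
    (hB : MeasurableSet B) (hμ : μ B ≠ ∞) :
    P {ω | pointCount X B ω = 0} = voidProb μ B := by
  have h : P {ω | pointCount X B ω = 0} = P.map (pointCount X B) {0} := by
    rw [Measure.map_apply (hX.measurable_count B hB) (measurableSet_singleton 0)]
    rfl
  have h0 : (Nat.cast : ℕ → ℕ∞) ⁻¹' {0} = {0} := by ext; simp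
  rw [h, hX.law_count B hB hμ, Measure.map_apply .of_discrete (measurableSet_singleton 0), h0,
    poissonMeasure_singleton]
  simp [voidProb, ENNReal.coe_toNNReal_eq_toReal]

lemma IsPoissonProcess.ae_finite (hX : IsPoissonProcess X μ P) (hμ : μ Set.univ ≠ ∞) :
    ∀ᵐ ω ∂P, (X ω).Finite := by
  have h : P {ω | pointCount X Set.univ ω = ⊤} = P.map (pointCount X Set.univ) {⊤} := by
    rw [Measure.map_apply (hX.measurable_count _ .univ) (measurableSet_singleton _)]
    rfl
  have h0 : (Nat.cast : ℕ → ℕ∞) ⁻¹' {⊤} = ∅ := by ext; simp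
  rw [hX.law_count _ .univ hμ, Measure.map_apply .of_discrete (measurableSet_singleton _), h0,
    measure_empty] at h
  have h' : ∀ᵐ ω ∂P, pointCount X Set.univ ω ≠ ⊤ := by
    rw [ae_iff]
    simpa using h
  filter_upwards [h'] with ω hω
  simpa [pointCount] using hω

lemma IsPoissonProcess.ae_notMem_of_measure_zero [IsProbabilityMeasure P]
    (hX : IsPoissonProcess X μ P) {B : Set E}
    (hB : MeasurableSet B) (hμ : μ B = 0) : ∀ᵐ ω ∂P, ∀ p ∈ X ω, p ∉ B := by
  have h := hX.measure_pointCount_eq_zero hB (by simp [hμ])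
  have hm : MeasurableSet {ω | pointCount X B ω = 0} :=
    hX.measurable_count B hB (measurableSet_singleton 0)
  simp only [voidProb, hμ, ENNReal.toReal_zero, neg_zero, Real.exp_zero, ENNReal.ofReal_one] at h
  filter_upwards [(prob_compl_eq_zero_iff hm).2 h] with ω hω
  exact pointCount_eq_zero.1 hω

lemma measurable_floor_mul {R : Ω → ℝ≥0} (hR : Measurable R) (m : ℕ) :
    Measurable (fun ω => ⌊(m + 1 : ℝ≥0) * R ω⌋₊) :=
  Nat.measurable_floor.comp (measurable_const.mul hR)

/-- The rounded radius takes countably many values. On each of them the set is deterministic, so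
independence splits the probability into a product. -/
lemma IsPoissonProcess.measure_upperGrid (hX : IsPoissonProcess X μ P) (hμ : μ Set.univ ≠ ∞)
    {R : Ω → ℝ≥0} (hR : Measurable R)
    (hind : Indep (pointSigma X) (MeasurableSpace.comap R inferInstance) P)
    {B : ℝ≥0 → Set E} (hB : ∀ ρ, MeasurableSet (B ρ)) (m : ℕ) :
    MeasurableSet {ω | pointCount X (B (upperGrid m (R ω))) ω = 0} ∧
    P {ω | pointCount X (B (upperGrid m (R ω))) ω = 0} =
      ∫⁻ ρ, voidProb μ (B (upperGrid m ρ)) ∂(P.map R) := by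
  set J : Ω → ℕ := fun ω => ⌊(m + 1 : ℝ≥0) * R ω⌋₊ with hJ
  have hJm : Measurable J := measurable_floor_mul hR m
  set g : ℕ → ℝ≥0 := fun j => (j + 1 : ℝ≥0) / (m + 1) with hg
  have hgrid : ∀ ω, upperGrid m (R ω) = g (J ω) := fun ω => rfl
  have hN : ∀ j, MeasurableSet {ω | pointCount X (B (g j)) ω = 0} := fun j =>
    hX.measurable_count _ (hB _) (measurableSet_singleton 0)
  have hfin : ∀ j, μ (B (g j)) ≠ ∞ := fun j => measure_ne_top_of_subset (Set.subset_univ _) hμ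
  have heq : {ω | pointCount X (B (upperGrid m (R ω))) ω = 0} =
      ⋃ j, ({ω | pointCount X (B (g j)) ω = 0} ∩ J ⁻¹' {j}) := by
    ext ω
    simp [hgrid]
  have hmeas : ∀ j, MeasurableSet ({ω | pointCount X (B (g j)) ω = 0} ∩ J ⁻¹' {j}) := fun j =>
    (hN j).inter (hJm (measurableSet_singleton j))
  refine ⟨heq ▸ MeasurableSet.iUnion hmeas, ?_⟩
  have hdisj : Pairwise (Function.onFun Disjoint
      fun j => ({ω | pointCount X (B (g j)) ω = 0} ∩ J ⁻¹' {j})) := by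
    intro i j hij
    refine Set.disjoint_left.2 fun ω hi hj => hij ?_
    exact hi.2.symm.trans hj.2
  rw [heq, measure_iUnion hdisj hmeas]
  have hprod : ∀ j, P ({ω | pointCount X (B (g j)) ω = 0} ∩ J ⁻¹' {j}) =
      voidProb μ (B (g j)) * P.map J {j} := by
    intro j
    rw [Indep_iff] at hind
    rw [hind, hX.measure_pointCount_eq_zero (hB _) (hfin j),
      Measure.map_apply hJm (measurableSet_singleton j)]
    · refine le_iSup (fun B : {B : Set E // MeasurableSet B} =>
        MeasurableSpace.comap (pointCount X B.1) inferInstance) ⟨B (g j), hB _⟩ _ ?_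
      exact ⟨{0}, measurableSet_singleton 0, rfl⟩
    · exact ⟨(fun ρ : ℝ≥0 => ⌊(m + 1 : ℝ≥0) * ρ⌋₊) ⁻¹' {j},
        measurable_floor_mul measurable_id m (measurableSet_singleton j), rfl⟩
  simp_rw [hprod]
  -- The sum over grid indices is an integral against the law of the index, which is itself a
  -- function of `R`.
  rw [← lintegral_countable' (fun j => voidProb μ (B (g j))), lintegral_map .of_discrete hJm,
    lintegral_map _ hR]
  · rfl
  exact (measurable_of_countable (fun j => voidProb μ (B (g j)))).comp
    (measurable_floor_mul measurable_id m)

/-- A Poisson process of finite intensity measure `μ` leaves an independently chosen member `B R`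
of a right-continuous increasing family of sets void with probability
`∫ exp (-μ (B ρ)) d(law of R)`. -/
lemma IsPoissonProcess.measure_void_random [IsProbabilityMeasure P]
    (hX : IsPoissonProcess X μ P) (hμ : μ Set.univ ≠ ∞)
    {R : Ω → ℝ≥0} (hR : Measurable R)
    (hind : Indep (pointSigma X) (MeasurableSpace.comap R inferInstance) P)
    {B : ℝ≥0 → Set E} (hB : ∀ ρ, MeasurableSet (B ρ)) (hmono : Monotone B)
    (hright : ∀ ρ p, (∀ ρ' > ρ, p ∈ B ρ') → p ∈ B ρ) :
    P {ω | ∀ p ∈ X ω, p ∉ B (R ω)} = ∫⁻ ρ, voidProb μ (B ρ) ∂(P.map R) := by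
  have hev : ∀ ρ p, p ∉ B ρ → ∀ᶠ m in atTop, p ∉ B (upperGrid m ρ) := by
    intro ρ p hp
    obtain ⟨ρ', hρ', hp'⟩ : ∃ ρ' > ρ, p ∉ B ρ' := by
      by_contra! h
      exact hp (hright ρ p h)
    filter_upwards [(tendsto_upperGrid ρ).eventually_lt_const hρ'] with m hm h
    exact hp' (hmono hm.le h)
  set A : ℕ → Set Ω := fun m => {ω | pointCount X (B (upperGrid m (R ω))) ω = 0} with hA
  have hAm : ∀ m, MeasurableSet (A m) := fun m => (hX.measure_upperGrid hμ hR hind hB m).1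
  -- Almost surely there are finitely many points, so a single `m` serves for all of them.
  -- Conversely, a point in `B R` lies in every larger `B`. Hence the events `A m` converge almost
  -- surely, and their liminf replaces an event not known to be measurable.
  have key : ∀ᵐ ω ∂P, ((∀ p ∈ X ω, p ∉ B (R ω)) → ∀ᶠ m in atTop, ω ∈ A m) ∧
      (¬ (∀ p ∈ X ω, p ∉ B (R ω)) → ∀ m, ω ∉ A m) := by
    filter_upwards [hX.ae_finite hμ] with ω hω
    constructor
    · intro h
      have := (Filter.eventually_all_finite hω).2 fun p hp => hev (R ω) p (h p hp)
      filter_upwards [this] with m hm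
      exact pointCount_eq_zero.2 hm
    · intro h m hm
      refine h fun p hp hp' => ?_
      exact pointCount_eq_zero.1 hm p hp (hmono (lt_upperGrid m _).le hp')
  have hlim : P {ω | ∀ p ∈ X ω, p ∉ B (R ω)} = P (liminf A atTop) := by
    refine measure_congr ?_
    filter_upwards [key] with ω hω
    refine propext (Iff.trans ?_ mem_liminf_iff_eventually_mem.symm)
    refine ⟨hω.1, fun h => ?_⟩
    by_contra h'
    obtain ⟨m, hm⟩ := h.exists
    exact hω.2 h' m hm
  have ht : Tendsto (fun m => P (A m)) atTop (𝓝 (P (liminf A atTop))) := by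
    refine tendsto_measure_of_ae_tendsto_indicator_of_isFiniteMeasure atTop
      (MeasurableSet.measurableSet_liminf hAm) hAm ?_
    filter_upwards [key] with ω hω
    by_cases h : ∀ p ∈ X ω, p ∉ B (R ω)
    · filter_upwards [hω.1 h] with m hm
      exact iff_of_true hm (mem_liminf_iff_eventually_mem.2 (hω.1 h))
    · refine Eventually.of_forall fun m => iff_of_false (hω.2 h m) fun h' => ?_
      obtain ⟨k, hk⟩ := (mem_liminf_iff_eventually_mem.1 h').exists
      exact hω.2 h k hk
  rw [hlim]
  refine tendsto_nhds_unique ht ?_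
  have hval : ∀ m, P (A m) = ∫⁻ ρ, voidProb μ (B (upperGrid m ρ)) ∂(P.map R) :=
    fun m => (hX.measure_upperGrid hμ hR hind hB m).2
  simp_rw [hval]
  have : IsProbabilityMeasure (P.map R) := Measure.isProbabilityMeasure_map hR.aemeasurable
  refine tendsto_lintegral_of_dominated_convergence (fun _ => 1) (fun m => ?_)
    (fun m => Eventually.of_forall fun ρ => voidProb_le_one _ _) (by simp)
    (Eventually.of_forall fun ρ => ?_)
  -- The integrand factors through a countable index, so no regularity in `ρ` is needed.
  · exact (measurable_of_countable
      (fun j : ℕ => voidProb μ (B ((j + 1 : ℝ≥0) / (m + 1))))).comp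
      (measurable_floor_mul measurable_id m)
  · refine tendsto_voidProb (measure_ne_top_of_subset (Set.subset_univ _) hμ) ?_
    refine tendsto_measure_of_ae_tendsto_indicator atTop (hB ρ) (fun m => hB _) .univ hμ
      (Eventually.of_forall fun m => Set.subset_univ _) (Eventually.of_forall fun p => ?_)
    by_cases hp : p ∈ B ρ
    · exact Eventually.of_forall fun m => iff_of_true (hmono (lt_upperGrid m ρ).le hp) hp
    · filter_upwards [hev ρ p hp] with m hm
      exact iff_of_false hm hp

end Poisson

/-! ### Connection sets on the torus and in Euclidean space -/

/-- The marked points `(ξ, r)` of the torus that are joined to `(0, ρ)` in the Gilbert graph. -/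
def connectionSet (d : ℕ) (n : ℝ) (ρ : ℝ≥0) : Set (Torus d n × ℝ≥0) :=
  {p | torusDist 0 p.1 ≤ max (ρ : ℝ) p.2}

/-- The counterpart in Euclidean space of `connectionSet`. -/
def euclideanConnectionSet (d : ℕ) (ρ : ℝ≥0) : Set ((Fin d → ℝ) × ℝ≥0) :=
  {p | Real.sqrt (∑ i, p.1 i ^ 2) ≤ max (ρ : ℝ) p.2}

/-- The cube of side length `n` centred at the origin. -/
def centredCube (d : ℕ) (n : ℝ) : Set (Fin d → ℝ) :=
  Set.Icc (fun _ => -(n / 2)) (fun _ => n / 2)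

lemma torusDist_comm {d : ℕ} {n : ℝ} (x y : Torus d n) : torusDist x y = torusDist y x := by
  simp only [torusDist, norm_sub_rev]

lemma isIsolatedIn_iff {d : ℕ} {n : ℝ} (S : Set (Torus d n × ℝ≥0)) (ρ : ℝ≥0) :
    IsIsolatedIn S (0, ρ) ↔ ∀ p ∈ S, p ≠ (0, ρ) → p ∉ connectionSet d n ρ := by
  simp only [IsIsolatedIn, SimpleGraph.IsIsolated, Digraph.toSimpleGraphInclusive,
    SimpleGraph.fromRel_adj, gilbertGraph, connectionSet, Set.mem_ofPred_eq, Subtype.forall]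
  constructor
  · intro h p hp hne hc
    refine h p (Or.inl hp) ⟨fun he => hne (Subtype.ext_iff.1 he).symm, ?_⟩
    rcases le_max_iff.1 hc with hc | hc
    · exact Or.inl hc
    · exact Or.inr (torusDist_comm _ _ ▸ hc)
  · rintro h p hp ⟨hne, hadj⟩
    have hne' : p ≠ (0, ρ) := fun he => hne (Subtype.ext he.symm)
    refine h p (hp.resolve_right hne') hne' (le_max_iff.2 (hadj.imp id fun h => ?_))
    exact torusDist_comm p.1 0 ▸ h

lemma measurable_torusDist_zero {d : ℕ} {n : ℝ} :
    Measurable (fun x : Torus d n => torusDist 0 x) := by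
  unfold torusDist
  fun_prop

lemma measurableSet_connectionSet (d : ℕ) (n : ℝ) (ρ : ℝ≥0) :
    MeasurableSet (connectionSet d n ρ) :=
  measurableSet_le (measurable_torusDist_zero.comp measurable_fst) (by fun_prop)

lemma measurableSet_euclideanConnectionSet (d : ℕ) (ρ : ℝ≥0) :
    MeasurableSet (euclideanConnectionSet d ρ) :=
  measurableSet_le (by fun_prop) (by fun_prop)

lemma connectionSet_mono (d : ℕ) (n : ℝ) : Monotone (connectionSet d n) := by
  intro a b hab p hp
  exact le_trans hp (max_le_max_right _ (NNReal.coe_le_coe.2 hab))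

lemma euclideanConnectionSet_mono (d : ℕ) : Monotone (euclideanConnectionSet d) := by
  intro a b hab p hp
  exact le_trans hp (max_le_max_right _ (NNReal.coe_le_coe.2 hab))

/-- Right-continuity comes from the closed inequality: a distance strictly above `max ρ r` still
exceeds it after a small increase of `ρ`. -/
lemma mem_connectionSet_of_forall_gt {d : ℕ} {n : ℝ} (ρ : ℝ≥0) (p : Torus d n × ℝ≥0)
    (h : ∀ ρ' > ρ, p ∈ connectionSet d n ρ') : p ∈ connectionSet d n ρ := by
  by_contra hp
  simp only [connectionSet, Set.mem_ofPred_eq, not_le, max_lt_iff] at hp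
  obtain ⟨t, ht, ht'⟩ := exists_between hp.1
  have ht0 : 0 ≤ t := ρ.2.trans ht.le
  have := h ⟨t, ht0⟩ ht
  exact absurd this (not_le.2 (max_lt ht' hp.2))

/-- On the centred cube every coordinate is its own shortest representative modulo `n`. -/
lemma torusDist_zero_coe {d : ℕ} {n : ℝ} (hn : 0 < n) {x : Fin d → ℝ} (hx : x ∈ centredCube d n) :
    torusDist (0 : Torus d n) (fun i => (x i : AddCircle n)) = Real.sqrt (∑ i, x i ^ 2) := by
  have : ∀ i, ‖(x i : AddCircle n)‖ = |x i| := fun i => by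
    rw [AddCircle.norm_coe_eq_abs_iff n hn.ne', abs_of_pos hn, abs_le]
    exact ⟨hx.1 i, hx.2 i⟩
  simp [torusDist, this]

lemma measurable_torusProj (d : ℕ) (n : ℝ) :
    Measurable (fun (x : Fin d → ℝ) i => (x i : AddCircle n)) := by
  refine measurable_pi_lambda _ fun i => ?_
  exact (AddCircle.continuous_mk' n).measurable.comp (measurable_pi_apply i)

lemma measurableSet_centredCube (d : ℕ) (n : ℝ) : MeasurableSet (centredCube d n) :=
  measurableSet_Icc

instance isFiniteMeasure_torusVolume (d : ℕ) (n : ℝ) : IsFiniteMeasure (torusVolume d n) := by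
  have : IsFiniteMeasure ((volume : Measure (Fin d → ℝ)).restrict
      (Set.Icc (fun _ => -(n / 2)) (fun _ => n / 2))) :=
    ⟨by simpa using isCompact_Icc.measure_lt_top⟩
  unfold torusVolume
  infer_instance

lemma torusVolume_prod (d : ℕ) (n : ℝ) (Q : Measure ℝ≥0) [SFinite Q] :
    (torusVolume d n).prod Q = ((volume.prod Q).restrict (centredCube d n ×ˢ Set.univ)).map
      (Prod.map (fun x i => (x i : AddCircle n)) id) := by
  rw [← Measure.prod_restrict, Measure.restrict_univ,
    ← Measure.map_prod_map _ _ (measurable_torusProj d n) measurable_id, Measure.map_id]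
  rfl

lemma torusVolume_prod_connectionSet (d : ℕ) {n : ℝ} (hn : 0 < n) (Q : Measure ℝ≥0) [SFinite Q]
    (ρ : ℝ≥0) :
    (torusVolume d n).prod Q (connectionSet d n ρ) =
      (volume.prod Q) (euclideanConnectionSet d ρ ∩ centredCube d n ×ˢ Set.univ) := by
  have hf : Measurable (Prod.map (fun (x : Fin d → ℝ) i => (x i : AddCircle n)) (id : ℝ≥0 → ℝ≥0)) :=
    (measurable_torusProj d n).prodMap measurable_id
  rw [torusVolume_prod, Measure.map_apply hf (measurableSet_connectionSet d n ρ),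
    Measure.restrict_apply (hf (measurableSet_connectionSet d n ρ))]
  congr 1
  ext p
  simp only [Set.mem_inter_iff, Set.mem_prod, Set.mem_univ, and_true, and_congr_left_iff]
  intro hp
  simp only [connectionSet, euclideanConnectionSet, Set.mem_preimage, Set.mem_ofPred_eq,
    Prod.map_fst, Prod.map_snd, torusDist_zero_coe hn hp, id]

lemma eventually_mem_centredCube {d : ℕ} {n : ℕ → ℝ} (hn : Tendsto n atTop atTop)
    (x : Fin d → ℝ) : ∀ᶠ k in atTop, x ∈ centredCube d (n k) := by
  filter_upwards [hn.eventually_ge_atTop (2 * ‖x‖)] with k hk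
  have h : ∀ i, |x i| ≤ n k / 2 := fun i => (norm_le_pi_norm x i).trans (by linarith)
  exact ⟨fun i => (abs_le.1 (h i)).1, fun i => (abs_le.1 (h i)).2⟩

lemma tendsto_torusVolume_prod_connectionSet (d : ℕ) {n : ℕ → ℝ} (hn0 : ∀ k, 1 ≤ n k)
    (hn : Tendsto n atTop atTop) (Q : Measure ℝ≥0) [SFinite Q] (ρ : ℝ≥0)
    (hfin : (volume.prod Q) (euclideanConnectionSet d ρ) ≠ ∞) :
    Tendsto (fun k => (torusVolume d (n k)).prod Q (connectionSet d (n k) ρ)) atTop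
      (𝓝 ((volume.prod Q) (euclideanConnectionSet d ρ))) := by
  have h : ∀ k, (torusVolume d (n k)).prod Q (connectionSet d (n k) ρ) =
      (volume.prod Q) (euclideanConnectionSet d ρ ∩ centredCube d (n k) ×ˢ Set.univ) := fun k =>
    torusVolume_prod_connectionSet d (zero_lt_one.trans_le (hn0 k)) Q ρ
  simp_rw [h]
  refine tendsto_measure_of_ae_tendsto_indicator atTop (measurableSet_euclideanConnectionSet d ρ)
    (fun k => (measurableSet_euclideanConnectionSet d ρ).inter
      ((measurableSet_centredCube d _).prod .univ)) (measurableSet_euclideanConnectionSet d ρ) hfin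
    (Eventually.of_forall fun k => Set.inter_subset_left) (Eventually.of_forall fun p => ?_)
  filter_upwards [eventually_mem_centredCube hn p.1] with k hk
  simp [hk]

/-! ### Finite moments and finite connection measure -/

lemma lintegral_pow_lt_top_of_tail {d : ℕ} (hd : 0 < d) {s β : ℝ} (hs : (d : ℝ) < s)
    (Q : Measure ℝ≥0) [IsFiniteMeasure Q]
    (hQ : Tendsto (fun h : ℝ => h ^ s * Q.real {r : ℝ≥0 | h < (r : ℝ)}) atTop (𝓝 β)) :
    ∫⁻ r : ℝ≥0, ENNReal.ofReal ((r : ℝ) ^ d) ∂Q < ∞ := by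
  have hd' : (0 : ℝ) < d := by exact_mod_cast hd
  obtain ⟨T, hT1, hT⟩ : ∃ T ≥ (1 : ℝ), ∀ h ≥ T,
      h ^ s * Q.real {r : ℝ≥0 | h < (r : ℝ)} ≤ β + 1 := by
    obtain ⟨T, hT⟩ := eventually_atTop.1 (hQ.eventually_le_const (lt_add_one β))
    exact ⟨max T 1, le_max_right _ _, fun h hh => hT h ((le_max_left _ _).trans hh)⟩
  have hT0 : 0 < T := by linarith
  have hlc := lintegral_rpow_eq_lintegral_meas_lt_mul Q (f := fun r : ℝ≥0 => (r : ℝ))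
    (Eventually.of_forall fun r => r.2) (by fun_prop) hd'
  simp only [Real.rpow_natCast] at hlc
  rw [hlc]
  refine ENNReal.mul_lt_top ENNReal.ofReal_lt_top ?_
  rw [← Set.Ioc_union_Ioi_eq_Ioi hT0.le]
  -- In the layer-cake integral, the total mass bounds the tail below `T`. Above `T` the integrand
  -- is at most a multiple of `t ^ (d - 1 - s)`, integrable since `s > d`.
  refine (lintegral_union_le _ _ _).trans_lt (ENNReal.add_lt_top.2 ⟨?_, ?_⟩)
  · have hb : ∀ t ∈ Set.Ioc 0 T, Q {r : ℝ≥0 | t < (r : ℝ)} * ENNReal.ofReal (t ^ ((d : ℝ) - 1)) ≤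
        Q Set.univ * ENNReal.ofReal (T ^ ((d : ℝ) - 1)) := by
      intro t ht
      have : (1 : ℝ) ≤ d := by exact_mod_cast hd
      exact mul_le_mul' (measure_mono (Set.subset_univ _))
        (ENNReal.ofReal_le_ofReal (Real.rpow_le_rpow ht.1.le ht.2 (by linarith)))
    refine (setLIntegral_mono' measurableSet_Ioc hb).trans_lt ?_
    rw [setLIntegral_const]
    exact ENNReal.mul_lt_top (ENNReal.mul_lt_top (measure_lt_top _ _) ENNReal.ofReal_lt_top)
      (by simp)
  · have hb : ∀ t ∈ Set.Ioi T, Q {r : ℝ≥0 | t < (r : ℝ)} * ENNReal.ofReal (t ^ ((d : ℝ) - 1)) ≤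
        ENNReal.ofReal ((β + 1) * t ^ ((d : ℝ) - 1 - s)) := by
      intro t ht
      have ht0 : 0 < t := hT0.trans ht
      rw [← ofReal_measureReal, ← ENNReal.ofReal_mul measureReal_nonneg]
      refine ENNReal.ofReal_le_ofReal ?_
      have := hT t (le_of_lt ht)
      calc Q.real {r : ℝ≥0 | t < (r : ℝ)} * t ^ ((d : ℝ) - 1)
          = (t ^ s * Q.real {r : ℝ≥0 | t < (r : ℝ)}) * t ^ ((d : ℝ) - 1 - s) := by
            rw [Real.rpow_sub ht0 _ s]
            have := (Real.rpow_pos_of_pos ht0 s).ne'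
            field_simp
        _ ≤ _ := by gcongr
    refine (setLIntegral_mono' measurableSet_Ioi hb).trans_lt ?_
    have hi : IntegrableOn (fun t : ℝ => (β + 1) * t ^ ((d : ℝ) - 1 - s)) (Set.Ioi T) :=
      (integrableOn_Ioi_rpow_of_lt (by linarith) hT0).const_mul _
    exact hi.lintegral_lt_top

/-- The Euclidean ball lies in the sup-norm ball, a cube of side `2 * t`; a crude bound suffices for
finiteness. -/
lemma volume_sqrt_sum_sq_le (d : ℕ) {t : ℝ} (ht : 0 ≤ t) :
    volume {x : Fin d → ℝ | Real.sqrt (∑ i, x i ^ 2) ≤ t} ≤ ENNReal.ofReal ((2 * t) ^ d) := by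
  have h := Real.volume_pi_closedBall (0 : Fin d → ℝ) ht
  rw [Fintype.card_fin] at h
  rw [← h]
  refine measure_mono fun x hx => ?_
  rw [mem_closedBall_zero_iff, pi_norm_le_iff_of_nonneg ht]
  intro i
  refine le_trans ?_ hx
  rw [Real.norm_eq_abs]
  exact Real.abs_le_sqrt (Finset.single_le_sum (f := fun i => x i ^ 2)
    (fun i _ => sq_nonneg _) (Finset.mem_univ i))

lemma volume_prod_euclideanConnectionSet_ne_top {d : ℕ} (Q : Measure ℝ≥0) [IsFiniteMeasure Q]
    (hQ : ∫⁻ r : ℝ≥0, ENNReal.ofReal ((r : ℝ) ^ d) ∂Q < ∞) (ρ : ℝ≥0) :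
    (volume.prod Q) (euclideanConnectionSet d ρ) ≠ ∞ := by
  rw [Measure.prod_apply_symm (measurableSet_euclideanConnectionSet d ρ)]
  have hb : ∀ r : ℝ≥0, volume ((fun x => (x, r)) ⁻¹' euclideanConnectionSet d ρ) ≤
      ENNReal.ofReal ((2 * ρ : ℝ) ^ d) + ENNReal.ofReal (2 ^ d) * ENNReal.ofReal ((r : ℝ) ^ d) := by
    intro r
    refine (volume_sqrt_sum_sq_le d (t := max (ρ : ℝ) r) (ρ.2.trans (le_max_left _ _))).trans ?_
    rw [← ENNReal.ofReal_mul (by positivity), ← mul_pow]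
    rcases max_choice (ρ : ℝ) r with h | h <;> rw [h]
    · exact le_self_add
    · exact le_add_self
  refine ((lintegral_mono hb).trans_lt ?_).ne
  rw [lintegral_add_left measurable_const, lintegral_const,
    lintegral_const_mul' _ _ ENNReal.ofReal_ne_top]
  exact ENNReal.add_lt_top.2 ⟨ENNReal.mul_lt_top ENNReal.ofReal_lt_top (measure_lt_top _ _),
    ENNReal.mul_lt_top ENNReal.ofReal_lt_top hQ⟩

/-! ### Isolation probability and its limit -/

/-- Isolation ignores a process point equal to the added vertex. Almost surely no process point sits
over the origin, so isolation and emptiness of the connection set agree almost surely. -/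
lemma torusVolume_prod_zero_fibre {d : ℕ} (hd : 0 < d) {n : ℝ} (hn : 0 < n)
    (Q : Measure ℝ≥0) [SFinite Q] :
    (torusVolume d n).prod Q ({0} ×ˢ Set.univ) = 0 := by
  rw [Measure.prod_prod]
  have : torusVolume d n {0} = 0 := by
    rw [torusVolume, Measure.map_apply (measurable_torusProj d n) (measurableSet_singleton _),
      Measure.restrict_apply (measurable_torusProj d n (measurableSet_singleton _))]
    refine measure_mono_null (t := {0}) ?_ ?_
    · rintro x ⟨hx, hx'⟩
      ext i
      have h1 : (x i : AddCircle n) = 0 := congrFun hx i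
      have h2 := (AddCircle.norm_coe_eq_abs_iff n hn.ne' (x := x i)).2
        (by rw [abs_of_pos hn, abs_le]; exact ⟨hx'.1 i, hx'.2 i⟩)
      simpa [h1] using h2.symm
    · have : Nonempty (Fin d) := ⟨⟨0, hd⟩⟩
      exact measure_singleton _
  simp [this]

lemma measure_isIsolatedIn {Ω : Type*} [MeasurableSpace Ω] {P : Measure Ω} [IsProbabilityMeasure P]
    {d : ℕ} (hd : 0 < d) {n : ℝ} (hn : 0 < n) {X : Ω → Set (Torus d n × ℝ≥0)} {R : Ω → ℝ≥0}
    {Q : Measure ℝ≥0} [IsProbabilityMeasure Q] (hX : IsMarkedPoisson X Q P) (hR : Measurable R)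
    (hQ : P.map R = Q)
    (hind : Indep (pointSigma X) (MeasurableSpace.comap R inferInstance) P) :
    P {ω | IsIsolatedIn (X ω) (0, R ω)} =
      ∫⁻ ρ, voidProb ((torusVolume d n).prod Q) (connectionSet d n ρ) ∂Q := by
  have hvoid := IsPoissonProcess.measure_void_random hX (measure_ne_top _ _) hR hind
    (measurableSet_connectionSet d n) (connectionSet_mono d n)
    (fun ρ p => mem_connectionSet_of_forall_gt ρ p)
  rw [hQ] at hvoid
  rw [← hvoid]
  refine measure_congr ?_
  filter_upwards [IsPoissonProcess.ae_notMem_of_measure_zero hX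
    ((measurableSet_singleton 0).prod .univ) (torusVolume_prod_zero_fibre hd hn Q)] with ω hω
  refine propext ((isIsolatedIn_iff _ _).trans (forall₂_congr fun p hp => ?_))
  refine ⟨fun h => h fun he => hω p hp ?_, fun h _ => h⟩
  simp [he]

/-- Larger radii have larger connection sets, and a monotone function of `ρ` is measurable. -/
lemma measurable_voidProb_connectionSet (d : ℕ) (n : ℝ) (Q : Measure ℝ≥0) [IsFiniteMeasure Q] :
    Measurable fun ρ => voidProb ((torusVolume d n).prod Q) (connectionSet d n ρ) :=
  Antitone.measurable fun _ _ h => voidProb_anti (connectionSet_mono d n h) (measure_ne_top _ _)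

lemma tendsto_lintegral_voidProb_connectionSet {d : ℕ} {Q : Measure ℝ≥0} [IsProbabilityMeasure Q]
    (hfin : ∀ ρ, (volume.prod Q) (euclideanConnectionSet d ρ) ≠ ∞)
    {n : ℕ → ℝ} (hn1 : ∀ k, 1 ≤ n k) (hn : Tendsto n atTop atTop) :
    Tendsto
      (fun k => ∫⁻ ρ, voidProb ((torusVolume d (n k)).prod Q) (connectionSet d (n k) ρ) ∂Q) atTop
      (𝓝 (∫⁻ ρ, voidProb (volume.prod Q) (euclideanConnectionSet d ρ) ∂Q)) :=
  tendsto_lintegral_of_dominated_convergence (fun _ => 1)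
    (fun k => measurable_voidProb_connectionSet d (n k) Q)
    (fun k => Eventually.of_forall fun ρ => voidProb_le_one _ _) (by simp)
    (Eventually.of_forall fun ρ => tendsto_voidProb (hfin ρ)
      (tendsto_torusVolume_prod_connectionSet d hn1 hn Q ρ (hfin ρ)))

theorem mainTheorem9
    (d : ℕ) (hd : 2 ≤ d) (s β : ℝ) (hs : (d : ℝ) < s) (hβ : 0 < β)
    -- the distribution `Q` on `[0, ∞)` of the typical mark: absolutely continuous, heavy-tailed
    (Q : Measure ℝ≥0) [IsProbabilityMeasure Q]
    (hQac : Q.map ((↑) : ℝ≥0 → ℝ) ≪ (volume : Measure ℝ))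
    (hQtail : Tendsto (fun h : ℝ => h ^ s * Q.real {r : ℝ≥0 | h < (r : ℝ)}) atTop (𝓝 β)) :
    -- the limit `p` depends only on `d` and `Q`
    ∃ p : ℝ, 0 < p ∧
      -- side lengths `n k ≥ 1` that tend to infinity
      ∀ (n : ℕ → ℝ), (∀ k, 1 ≤ n k) → Tendsto n atTop atTop →
      -- the marked Poisson process `X k` on the torus of side length `n k`, and an independent
      -- copy `R k` of the typical mark
      ∀ (Ω : ℕ → Type*) [∀ k, MeasurableSpace (Ω k)]
        (P : ∀ k, Measure (Ω k)) [∀ k, IsProbabilityMeasure (P k)]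
        (X : ∀ k, Ω k → Set (Torus d (n k) × ℝ≥0)) (R : ∀ k, Ω k → ℝ≥0),
        (∀ k, IsMarkedPoisson (X k) Q (P k)) →
        (∀ k, Measurable (R k)) →
        (∀ k, (P k).map (R k) = Q) →
        (∀ k, Indep (pointSigma (X k)) (MeasurableSpace.comap (R k) inferInstance) (P k)) →
        Tendsto (fun k => (P k).real {ω | IsIsolatedIn (X k ω) (0, R k ω)}) atTop (𝓝 p) := by
  have hd0 : 0 < d := by omega
  have hfin := volume_prod_euclideanConnectionSet_ne_top Q
    (lintegral_pow_lt_top_of_tail hd0 hs Q hQtail)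
  set V : ℝ≥0 → ℝ≥0∞ := fun ρ => voidProb (volume.prod Q) (euclideanConnectionSet d ρ) with hV
  have hVm : Measurable V := Antitone.measurable fun _ b h =>
    voidProb_anti (euclideanConnectionSet_mono d h) (hfin b)
  have htop : ∫⁻ ρ, V ρ ∂Q ≠ ∞ :=
    ((lintegral_mono fun ρ => voidProb_le_one _ _).trans_lt (by simp)).ne
  have hpos : 0 < ∫⁻ ρ, V ρ ∂Q := by
    -- An exponential of a real number never vanishes. Finiteness from `hfin` matters elsewhere:
    -- `toReal` would send an infinite measure to `0`.
    have hsupp : Function.support V = Set.univ := by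
      ext ρ
      simp [hV, voidProb, Real.exp_pos]
    rw [lintegral_pos_iff_support hVm, hsupp]
    simp
  refine ⟨(∫⁻ ρ, V ρ ∂Q).toReal, ENNReal.toReal_pos hpos.ne' htop, ?_⟩
  intro n hn1 hn Ω _ P _ X R hX hR hRQ hind
  have hval : ∀ k, (P k).real {ω | IsIsolatedIn (X k ω) (0, R k ω)} =
      (∫⁻ ρ, voidProb ((torusVolume d (n k)).prod Q) (connectionSet d (n k) ρ) ∂Q).toReal :=
    fun k => congrArg ENNReal.toReal
      (measure_isIsolatedIn hd0 (zero_lt_one.trans_le (hn1 k)) (hX k) (hR k) (hRQ k) (hind k))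
  refine Tendsto.congr (fun k => (hval k).symm) ?_
  exact (ENNReal.tendsto_toReal htop).comp (tendsto_lintegral_voidProb_connectionSet hfin hn1 hn)
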